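/- Let $n\ge 2$ and $\varepsilon\in\{1,-1\}$. Let $B_n$ be the hyperoctahedral group of signed permutations $\sigma=\sigma_1\cdots\sigma_n$ of $[n]=\{1,\dots,n\}$ (that is, $\sigma_i\in\{\pm1,\dots,\pm n\}$ and $|\sigma_1|\cdots|\sigma_n|$ is a permutation of $[n]$), and let $\ell_B(\sigma)$ be the Coxeter length of $\sigma$: the least number of factors in an expression of $\sigma$ as a product of the generators $s_0=(1,-1)$ (changing the sign of $1$) and $s_i=(i,i+1)$, $1\le i\le n-1$. Let $$\operatorname{fmaj}(\sigma)=2\sum_{\substack{1\le i\le n-1\\ \sigma_{i+1}\prec\sigma_i}} i+\#\{i\in[n]:\sigma_i<0\},$$ where $\prec$ is the order $-1\prec-2\prec\cdots\prec-n\prec0\prec 1\prec2\prec\cdots\prec n$. Let $$\mathcal D^{\Delta}_n=\{\sigma\in B_n:\ \sigma_n>0\ \text{and}\ \sigma_i\ne i\ \text{for all } i\in[n]\}$$ be the set of signed derangements whose last letter is positive, and write $[m]_q=1+q+\cdots+q^{m-1}$ for $m\ge1$. Then, in the field $\mathbb{Q}(q)$ of rational functions in the indeterminate $q$, $$\sum_{\sigma\in\mathcal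 D^{\Delta}_n}\varepsilon^{\ell_B(\sigma)}q^{\operatorname{fmaj}(\sigma)}=[2]_q[4]_q\cdots[2n-2]_q\sum_{k=0}^{n-2}\frac{(-1)^kq^{k^2+k+1}[n-k-1]_q}{[2]_q[4]_q\cdots[2k]_q}\,\varepsilon^{n-k}\left(\frac{1-q}{1-\varepsilon q}\right)^{\lceil (n-k)/2\rceil},$$ where the empty product $[2]_q\cdots[2k]_q$ for $k=0$ is $1$. -/

import Mathlib

/-- A signed permutation `σ` of `[n] = {1, …, n}`, an element of the hyperoctahedral group `B_n`.
Positions and absolute values are indexed by `Fin n`, so that `i : Fin n` stands for the number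
`i + 1`; `perm` is the permutation `|σ|`, and `sgn i` is the sign of the letter at position `i`. -/
@[ext]
structure SignedPerm (n : ℕ) where
  perm : Equiv.Perm (Fin n)
  sgn : Fin n → ℤˣ

namespace SignedPerm

variable {n : ℕ}

/-- A signed permutation is a pair consisting of a permutation and a choice of signs. -/
def equivProd (n : ℕ) : SignedPerm n ≃ Equiv.Perm (Fin n) × (Fin n → ℤˣ) where
  toFun σ := (σ.perm, σ.sgn)
  invFun p := ⟨p.1, p.2⟩
  left_inv _ := rfl
  right_inv _ := rfl

instance : Fintype (SignedPerm n) := Fintype.ofEquiv _ (equivProd n).symm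

/-- The letter `σ_{i+1}` of the signed word `σ = σ_1 ⋯ σ_n`. -/
def letter (σ : SignedPerm n) (i : Fin n) : ℤ := (σ.sgn i : ℤ) * (((σ.perm i : ℕ) : ℤ) + 1)

/-! ### The group structure and the Coxeter length -/

instance : One (SignedPerm n) := ⟨⟨1, fun _ => 1⟩⟩

/-- Composition of signed permutations, `(σ τ)(i) = σ(τ(i))`, where `σ(-i) = -σ(i)`. -/
instance : Mul (SignedPerm n) :=
  ⟨fun σ τ => ⟨σ.perm * τ.perm, fun i => τ.sgn i * σ.sgn (τ.perm i)⟩⟩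

instance : Inv (SignedPerm n) :=
  ⟨fun σ => ⟨σ.perm⁻¹, fun i => (σ.sgn (σ.perm⁻¹ i))⁻¹⟩⟩

theorem mul_def (σ τ : SignedPerm n) :
    σ * τ = ⟨σ.perm * τ.perm, fun i => τ.sgn i * σ.sgn (τ.perm i)⟩ := rfl

theorem one_def : (1 : SignedPerm n) = ⟨1, fun _ => 1⟩ := rfl

theorem inv_def (σ : SignedPerm n) :
    σ⁻¹ = ⟨σ.perm⁻¹, fun i => (σ.sgn (σ.perm⁻¹ i))⁻¹⟩ := rfl

instance : Group (SignedPerm n) :=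
  Group.ofLeftAxioms
    (fun a b c => by
      simp only [mul_def, mul_assoc, Equiv.Perm.mul_apply])
    (fun a => by
      simp only [mul_def, one_def, one_mul, mul_one])
    (fun a => by
      have h : ∀ i, a.perm⁻¹ (a.perm i) = i := fun i => a.perm.symm_apply_apply i
      simp only [mul_def, one_def, inv_def, inv_mul_cancel, h,
        mul_inv_cancel])

/-- The sign change that sends `i` to `-i` and fixes every other element of `[n]`. -/
def signChange (i : Fin n) : SignedPerm n := ⟨1, Pi.mulSingle i (-1)⟩

/-- The transposition that exchanges `i` and `j`. -/
def transposition (i j : Fin n) : SignedPerm n := ⟨Equiv.swap i j, fun _ => 1⟩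

/-- The Coxeter generators of `B_n`: the sign change `s_0 = (1, -1)` and the adjacent
transpositions `s_i = (i, i + 1)` for `1 ≤ i ≤ n - 1`. -/
def generators (n : ℕ) : Set (SignedPerm n) :=
  {s | ∃ i : Fin n, (i : ℕ) = 0 ∧ s = signChange i} ∪
    {s | ∃ i j : Fin n, (j : ℕ) = (i : ℕ) + 1 ∧ s = transposition i j}

/-- The length `ℓ_B(σ)`: the least number of Coxeter generators in a product equal to `σ`. -/
noncomputable def lengthB (σ : SignedPerm n) : ℕ :=
  sInf {k : ℕ | ∃ w : List (SignedPerm n), w.length = k ∧ (∀ s ∈ w, s ∈ generators n) ∧ w.prod = σ}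

/-! ### The flag major index -/

/-- The strict order `-1 ≺ -2 ≺ ⋯ ≺ -n ≺ 0 ≺ 1 ≺ 2 ≺ ⋯ ≺ n` on the letters. -/
def Prec (a b : ℤ) : Prop :=
  (a < 0 ∧ b < 0 ∧ b < a) ∨ (a < 0 ∧ 0 ≤ b) ∨ (0 ≤ a ∧ a < b)

instance : DecidableRel Prec := fun a b => by unfold Prec; infer_instance

/-- The descents of the word `σ_1 ⋯ σ_n` with respect to the order `≺`; the element `i : Fin n`
stands for the descent `i + 1`. -/
def descents (σ : SignedPerm n) : Finset (Fin n) :=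
  {i | ∃ h : (i : ℕ) + 1 < n, Prec (σ.letter ⟨(i : ℕ) + 1, h⟩) (σ.letter i)}

/-- The major index of the word `σ_1 ⋯ σ_n` with respect to the order `≺`. -/
def maj (σ : SignedPerm n) : ℕ := ∑ i ∈ σ.descents, ((i : ℕ) + 1)

/-- The number of negative letters. -/
def neg (σ : SignedPerm n) : ℕ := (Finset.univ.filter fun i : Fin n => σ.letter i < 0).card

/-- The flag major index. -/
def fmaj (σ : SignedPerm n) : ℕ := 2 * σ.maj + σ.neg

/-! ### Signed derangements whose last letter is positive -/

/-- `σ` has no fixed point, that is, `σ_i ≠ i` for all `i ∈ [n]`. -/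
def IsDerangement (σ : SignedPerm n) : Prop := ∀ i : Fin n, σ.letter i ≠ ((i : ℕ) : ℤ) + 1

instance : DecidablePred (IsDerangement (n := n)) := fun σ => by
  unfold IsDerangement; infer_instance

/-- The last letter `σ_n` is positive. -/
def LastPos (σ : SignedPerm n) : Prop := ∀ i : Fin n, (i : ℕ) + 1 = n → 0 < σ.letter i

instance : DecidablePred (LastPos (n := n)) := fun σ => by
  unfold LastPos; infer_instance

/-- The set of signed derangements `σ ∈ B_n` with `σ_n > 0`. -/
def derangementsDelta (n : ℕ) : Finset (SignedPerm n) := {σ | σ.IsDerangement ∧ σ.LastPos}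

end SignedPerm

/-- The `q`-integer `[m]_q = 1 + q + ⋯ + q^(m-1)`, for `m ≥ 1`. -/
def qInt {K : Type*} [CommRing K] (q : K) (m : ℕ) : K := ∑ i ∈ Finset.range m, q ^ i

/-- The product `[2]_q [4]_q ⋯ [2m]_q`. -/
def qEvenProd {K : Type*} [CommRing K] (q : K) (m : ℕ) : K :=
  ∏ i ∈ Finset.Icc 1 m, qInt q (2 * i)

/-- The signed Mahonian polynomial `∑ ε^(ℓ_B(σ)) q^(fmaj(σ))` over the signed derangements
`σ ∈ B_n` with `σ_n > 0`. -/
noncomputable def dDelta {K : Type*} [CommRing K] (n : ℕ) (ε q : K) : K :=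
  ∑ σ ∈ SignedPerm.derangementsDelta n, ε ^ σ.lengthB * q ^ σ.fmaj

/-! Write d_m for `dDelta m ε q`, and let c_n be the sum of ε^ℓ q^fmaj over all signed permutations
of [n+1] whose last letter is positive and not a fixed point. The proof computes c_n in two ways.

By the last letter. Since ε² = 1, ε^ℓ depends only on the character `signChar`, which changes in a
controlled way when a letter is appended. Induction on n gives `sum_weight_snoc`: if exactly j
letters of the alphabet exceed the letter x, the signed permutations ending in x contribute (ε^(n+1)
q)^j ∏_{i≤n} [2i]_{ε^i q}. Summing over 1 ≤ j ≤ n gives c_n (`sum_weight_last`).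

By the fixed points. Deleting them and standardizing leaves a derangement α of size k+1 with
positive last letter, and σ is a shuffle of α with an increasing word. How a letter of α compares
with an adjacent fixed point depends only on α (`prec_expand_iff`), so the major index over all
shuffles is governed by Gaussian coefficients (`Shuffle.endFirst_endSecond`). This yields c_n = ∑_k
q^(2(n-k)) (n choose k)_{q²} d_{k+1} (`sum_weight_last_eq_sum_dDelta`).

A q-exponential inversion (`gaussBinom_inversion`) solves for d_{n+1}, and `mahonian_mul_eq`
evaluates c_n using ε² = 1. -/

namespace SignedPerm
-- Length parity as a linear character
variable {n : ℕ}

/-- The linear character of `B_n` that sends every Coxeter generator to `-1`. -/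
def signChar : SignedPerm n →* ℤˣ where
  toFun σ := Equiv.Perm.sign σ.perm * ∏ i, σ.sgn i
  map_one' := by simp [one_def]
  map_mul' σ τ := by
    simp only [mul_def, map_mul, Finset.prod_mul_distrib, Equiv.prod_comp τ.perm σ.sgn]
    ac_rfl

theorem signChar_apply (σ : SignedPerm n) :
    signChar σ = Equiv.Perm.sign σ.perm * ∏ i, σ.sgn i := rfl

theorem signChar_of_mem_generators {s : SignedPerm n} (hs : s ∈ generators n) :
    signChar s = -1 := by
  rcases hs with ⟨i, -, rfl⟩ | ⟨i, j, hij, rfl⟩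
  · simp [signChar_apply, signChange]
  · have : i ≠ j := by rintro rfl; omega
    simp [signChar_apply, transposition, Equiv.Perm.sign_swap this]

/-- The embedding of the symmetric group as the unsigned permutations. -/
def ofPerm : Equiv.Perm (Fin n) →* SignedPerm n where
  toFun π := ⟨π, fun _ => 1⟩
  map_one' := rfl
  map_mul' _ _ := by simp [mul_def]

/-- The embedding of the group of sign patterns. -/
def ofSigns : (Fin n → ℤˣ) →* SignedPerm n where
  toFun s := ⟨1, s⟩
  map_one' := rfl
  map_mul' s t := by
    simp only [mul_def, mul_one, Equiv.Perm.one_apply]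
    congr 1
    funext i
    exact mul_comm _ _

theorem ofPerm_mem_closure (π : Equiv.Perm (Fin n)) :
    ofPerm π ∈ Submonoid.closure (generators n) := by
  rcases n with _ | n
  · rw [Subsingleton.elim π 1, map_one]
    exact one_mem _
  · have h : π ∈ Submonoid.closure
        (Set.range fun i : Fin n => Equiv.swap i.castSucc i.succ) := by
      rw [Equiv.Perm.mclosure_swap_castSucc_succ]; trivial
    induction h using Submonoid.closure_induction with
    | mem x hx =>
      obtain ⟨i, rfl⟩ := hx
      exact Submonoid.subset_closure (Or.inr ⟨i.castSucc, i.succ, by simp, rfl⟩)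
    | one => rw [map_one]; exact one_mem _
    | mul x y _ _ hx hy => rw [map_mul]; exact mul_mem hx hy

/-- Each sign change is conjugate to s_0 by a transposition. -/
theorem signChange_mem_closure (i : Fin n) :
    signChange i ∈ Submonoid.closure (generators n) := by
  rcases n with _ | n
  · exact i.elim0
  · have h : signChange i = ofPerm (Equiv.swap 0 i) * signChange 0 * ofPerm (Equiv.swap 0 i) := by
      simp only [signChange, ofPerm, mul_def, MonoidHom.coe_mk, OneHom.coe_mk]
      ext j
      · simp
      · congr 1
        rcases eq_or_ne j i with rfl | hj
        · simp
        · have : Equiv.swap 0 i j ≠ 0 := fun h => hj <| by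
            rw [← Equiv.swap_apply_left 0 i] at h
            simpa using congrArg (Equiv.swap 0 i) h
          simp [hj, this]
    rw [h]
    exact mul_mem (mul_mem (ofPerm_mem_closure _)
      (Submonoid.subset_closure (Or.inl ⟨0, rfl, rfl⟩))) (ofPerm_mem_closure _)

/-- Guarantees that the set of word lengths in `lengthB` is nonempty, so that its `sInf` is attained
by a word rather than being the default 0. The submonoid closure is the right one because words
contain no inverses. -/
theorem closure_generators : Submonoid.closure (generators n) = ⊤ := by
  refine eq_top_iff.2 fun σ _ => ?_
  have hs : ∀ s : Fin n → ℤˣ, s ∈ (Submonoid.closure (generators n)).comap ofSigns := by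
    intro s
    rw [← Finset.univ_prod_mulSingle s]
    refine prod_mem fun i _ => ?_
    rcases Int.units_eq_one_or (s i) with h | h <;> rw [h]
    · rw [Pi.mulSingle_one]; exact one_mem _
    · exact signChange_mem_closure i
  have h : σ = ofPerm σ.perm * ofSigns σ.sgn := by simp [ofPerm, ofSigns, mul_def]
  rw [h]
  exact mul_mem (ofPerm_mem_closure _) (hs _)

theorem neg_one_pow_lengthB (σ : SignedPerm n) : (-1) ^ σ.lengthB = signChar σ := by
  have hne : {k : ℕ | ∃ w : List (SignedPerm n), w.length = k ∧ (∀ s ∈ w, s ∈ generators n) ∧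
      w.prod = σ}.Nonempty := by
    have h : σ ∈ Submonoid.closure (generators n) := by rw [closure_generators]; trivial
    obtain ⟨w, hw, hp⟩ := Submonoid.exists_list_of_mem_closure h
    exact ⟨w.length, w, rfl, hw, hp⟩
  obtain ⟨w, hl, hw, rfl⟩ := Nat.sInf_mem hne
  rw [lengthB, ← hl, map_list_prod]
  have : w.map signChar = List.replicate w.length (-1) := by
    refine List.eq_replicate_iff.2 ⟨by simp, fun b hb => ?_⟩
    obtain ⟨s, hs, rfl⟩ := List.mem_map.1 hb
    exact signChar_of_mem_generators (hw s hs)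
  rw [this, List.prod_replicate]

/-- Only the parity of the length matters when ε² = 1. Parities are compared in ℤˣ, because 1 = -1
is possible in `K`. The two groups may have different ranks, as needed for appending letters and for
deleting fixed points. -/
theorem pow_lengthB_congr {K : Type*} [CommRing K] {ε : K} (hε : ε ^ 2 = 1) {m : ℕ}
    {σ : SignedPerm n} {τ : SignedPerm m} (c : ℕ) (h : signChar σ = (-1) ^ c * signChar τ) :
    ε ^ σ.lengthB = ε ^ c * ε ^ τ.lengthB := by
  rw [← neg_one_pow_lengthB, ← neg_one_pow_lengthB, ← pow_add] at h
  rw [← pow_add]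
  have key : ∀ a b : ℕ, (-1 : ℤˣ) ^ a = (-1) ^ b → ε ^ a = ε ^ b := by
    intro a b hab
    have hp : ∀ a : ℕ, ε ^ a = ε ^ (a % 2) := fun a => by
      conv_lhs => rw [← Nat.div_add_mod a 2, pow_add, pow_mul, hε, one_pow, one_mul]
    rw [hp a, hp b]
    rcases Nat.even_or_odd a with ha | ha <;> rcases Nat.even_or_odd b with hb | hb
    · rw [Nat.even_iff.1 ha, Nat.even_iff.1 hb]
    · rw [ha.neg_one_pow, hb.neg_one_pow] at hab; exact absurd hab (by decide)
    · rw [ha.neg_one_pow, hb.neg_one_pow] at hab; exact absurd hab (by decide)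
    · rw [Nat.odd_iff.1 ha, Nat.odd_iff.1 hb]
  exact key _ _ h

end SignedPerm

namespace SignedPerm
variable {n : ℕ}

/-! ### The flag major index as a sum over positions -/

theorem letter_neg_iff (σ : SignedPerm n) (i : Fin n) : σ.letter i < 0 ↔ σ.sgn i = -1 := by
  rcases Int.units_eq_one_or (σ.sgn i) with h | h <;> simp [letter, h] <;> omega

theorem neg_eq_sum (σ : SignedPerm n) : σ.neg = ∑ i, if σ.sgn i = -1 then 1 else 0 := by
  simp only [neg, letter_neg_iff, Finset.card_filter]

theorem maj_eq_sum (σ : SignedPerm (n + 1)) :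
    σ.maj = ∑ i : Fin n,
      if Prec (σ.letter i.succ) (σ.letter i.castSucc) then (i : ℕ) + 1 else 0 := by
  rw [maj, descents, Finset.sum_filter, Fin.sum_univ_castSucc]
  simp only [Fin.val_last, lt_irrefl, IsEmpty.exists_iff, if_false, add_zero]
  refine Finset.sum_congr rfl fun i _ => ?_
  have h : (i.castSucc : ℕ) + 1 < n + 1 := by simp
  simp only [h, exists_true_left]
  rfl

theorem maj_of_le_one (hn : n ≤ 1) (σ : SignedPerm n) : σ.maj = 0 := by
  rw [maj, descents]
  refine Finset.sum_eq_zero fun i hi => ?_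
  obtain ⟨h, -⟩ := (Finset.mem_filter.1 hi).2
  omega

/-- The order `≺` depends only on the signs and on the relative order of the absolute values. -/
theorem prec_congr (s t : ℤˣ) {i j i' j' : ℕ} (h : i < j ↔ i' < j') (h' : j < i ↔ j' < i') :
    Prec (s * ((i : ℤ) + 1)) (t * ((j : ℤ) + 1)) ↔
      Prec (s * ((i' : ℤ) + 1)) (t * ((j' : ℤ) + 1)) := by
  rcases Int.units_eq_one_or s with rfl | rfl <;> rcases Int.units_eq_one_or t with rfl | rfl <;>
    simp [Prec] <;> omega

/-! ### Appending a last letter -/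

/-- The permutation with last value `a` whose other values are in the same relative order as
those of `π`. -/
def snocPerm (a : Fin (n + 1)) (π : Equiv.Perm (Fin n)) : Equiv.Perm (Fin (n + 1)) :=
  a.cycleRange.symm * Equiv.Perm.decomposeFin.symm (0, π) * finRotate (n + 1)

theorem snocPerm_last (a : Fin (n + 1)) (π : Equiv.Perm (Fin n)) :
    snocPerm a π (Fin.last n) = a := by
  simp [snocPerm]

theorem snocPerm_castSucc (a : Fin (n + 1)) (π : Equiv.Perm (Fin n)) (i : Fin n) :
    snocPerm a π i.castSucc = a.succAbove (π i) := by
  simp [snocPerm]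

theorem sign_snocPerm (a : Fin (n + 1)) (π : Equiv.Perm (Fin n)) :
    Equiv.Perm.sign (snocPerm a π) = (-1) ^ (n - a : ℕ) * Equiv.Perm.sign π := by
  have h : (-1 : ℤˣ) ^ (a : ℕ) * (-1) ^ n = (-1) ^ (n - a : ℕ) := by
    have ha := a.2
    rw [← pow_add, show (a : ℕ) + n = 2 * a + (n - a) by omega, pow_add, pow_mul]
    simp
  simp only [snocPerm, map_mul, Equiv.Perm.sign_symm, Fin.sign_cycleRange,
    Equiv.Perm.decomposeFin.symm_sign, sign_finRotate, if_true, one_mul, add_tsub_cancel_right]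
  rw [← h]
  ac_rfl

/-- The signed permutation whose last letter has absolute value `a` and sign `s`, and whose other
letters are in the same relative order as those of `τ`. -/
def snoc (a : Fin (n + 1)) (s : ℤˣ) (τ : SignedPerm n) : SignedPerm (n + 1) :=
  ⟨snocPerm a τ.perm, Fin.snoc (α := fun _ => ℤˣ) τ.sgn s⟩

variable (a : Fin (n + 1)) (s : ℤˣ) (τ : SignedPerm n)

theorem letter_snoc_last : (snoc a s τ).letter (Fin.last n) = s * (((a : ℕ) : ℤ) + 1) := by
  simp [letter, snoc, snocPerm_last]

theorem letter_snoc_castSucc (i : Fin n) :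
    (snoc a s τ).letter i.castSucc = τ.sgn i * (((a.succAbove (τ.perm i) : ℕ) : ℤ) + 1) := by
  simp [letter, snoc, snocPerm_castSucc]

theorem signChar_snoc :
    signChar (snoc a s τ) = (-1) ^ (n - a + if s = -1 then 1 else 0 : ℕ) * signChar τ := by
  have hs : s = (-1) ^ (if s = -1 then 1 else 0 : ℕ) := by
    rcases Int.units_eq_one_or s with rfl | rfl <;> decide
  have hp : ∏ i, (snoc a s τ).sgn i = (∏ i, τ.sgn i) * s := by
    simp [Fin.prod_univ_castSucc, snoc]
  rw [signChar_apply, signChar_apply, hp, pow_add, ← hs]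
  simp only [snoc, sign_snocPerm]
  ac_rfl

theorem neg_snoc : (snoc a s τ).neg = τ.neg + if s = -1 then 1 else 0 := by
  rw [neg_eq_sum, neg_eq_sum, Fin.sum_univ_castSucc]
  simp only [snoc, Fin.snoc_castSucc, Fin.snoc_last]

theorem succAbove_val_lt_iff (i j : Fin n) :
    (a.succAbove i : ℕ) < a.succAbove j ↔ (i : ℕ) < j := by
  rw [← Fin.lt_def, Fin.succAbove_lt_succAbove_iff, Fin.lt_def]

/-- Appending a letter preserves the signs and the relative order of the earlier absolute values,
hence all earlier descents; only the last adjacent pair is new. -/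
theorem maj_snoc (a : Fin (n + 2)) (τ : SignedPerm (n + 1)) :
    (snoc a s τ).maj = τ.maj +
      if Prec (s * (((a : ℕ) : ℤ) + 1))
        (τ.sgn (Fin.last n) * (((a.succAbove (τ.perm (Fin.last n)) : ℕ) : ℤ) + 1))
      then n + 1 else 0 := by
  rw [maj_eq_sum, maj_eq_sum, Fin.sum_univ_castSucc]
  congr 1
  · refine Finset.sum_congr rfl fun i _ => ?_
    have : i.castSucc.succ = i.succ.castSucc := rfl
    rw [this, letter_snoc_castSucc, letter_snoc_castSucc]
    congr 1
    exact propext (prec_congr _ _ (succAbove_val_lt_iff _ _ _) (succAbove_val_lt_iff _ _ _))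
  · rw [Fin.succ_last, letter_snoc_last, letter_snoc_castSucc]
    rfl

theorem snoc_injective : Function.Injective
    fun p : (Fin (n + 1) × ℤˣ) × SignedPerm n => snoc p.1.1 p.1.2 p.2 := by
  rintro ⟨⟨a, s⟩, τ⟩ ⟨⟨b, t⟩, ρ⟩ h
  obtain ⟨hp, hs⟩ := SignedPerm.ext_iff.1 h
  have ha : a = b := by simpa [snoc, snocPerm_last] using DFunLike.congr_fun hp (Fin.last n)
  subst ha
  have hst : s = t := by simpa [snoc] using congrFun hs (Fin.last n)
  subst hst
  congr 1
  ext i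
  · have := DFunLike.congr_fun hp i.castSucc
    simp only [snoc, snocPerm_castSucc] at this
    rw [a.succAbove_right_injective this]
  · have := congrFun hs i.castSucc
    simp only [snoc, Fin.snoc_castSucc] at this
    rw [this]

theorem card_eq : Fintype.card (SignedPerm n) = n.factorial * 2 ^ n := by
  rw [Fintype.card_congr (equivProd n), Fintype.card_prod, Fintype.card_perm, Fintype.card_fun,
    Fintype.card_units_int, Fintype.card_fin]

theorem snoc_bijective : Function.Bijective
    fun p : (Fin (n + 1) × ℤˣ) × SignedPerm n => snoc p.1.1 p.1.2 p.2 := by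
  refine (Fintype.bijective_iff_injective_and_card _).2 ⟨snoc_injective, ?_⟩
  simp only [Fintype.card_prod, card_eq, Fintype.card_units_int, Fintype.card_fin,
    Nat.factorial_succ]
  ring

theorem sum_eq_sum_snoc {M : Type*} [AddCommMonoid M] (f : SignedPerm (n + 1) → M) :
    ∑ σ, f σ = ∑ a : Fin (n + 1), ∑ s : ℤˣ, ∑ τ : SignedPerm n, f (snoc a s τ) := by
  rw [← snoc_bijective.sum_comp f, Fintype.sum_prod_type, Fintype.sum_prod_type]

/-! ### The signed Mahonian distribution according to the last letter -/

/-- The exponent contributed by the last letter; it numbers the letters in decreasing order. -/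
def lastExp (a : Fin (n + 1)) (s : ℤˣ) : ℕ := if s = -1 then 2 * n + 1 - a else n - a

/-- The positive letters take the exponents 0, …, n and the negative ones n+1, …, 2n+1, each once.
-/
theorem sum_lastExp {M : Type*} [AddCommMonoid M] (f : ℕ → M) :
    ∑ a : Fin (n + 1), ∑ s : ℤˣ, f (lastExp a s) = ∑ j ∈ Finset.range (2 * (n + 1)), f j := by
  have hu : ∀ g : ℤˣ → M, ∑ s, g s = g 1 + g (-1) := fun g => by
    rw [show (Finset.univ : Finset ℤˣ) = {1, -1} from rfl, Finset.sum_pair (by decide)]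
  have h1 : (1 : ℤˣ) ≠ -1 := by decide
  simp only [hu, lastExp, if_neg h1, if_true, Finset.sum_add_distrib]
  rw [two_mul (n + 1), Finset.sum_range_add, Fin.sum_univ_eq_sum_range (fun a => f (n - a)) (n + 1),
    Fin.sum_univ_eq_sum_range (fun a => f (2 * n + 1 - a)) (n + 1),
    ← Finset.sum_range_reflect f, ← Finset.sum_range_reflect (fun j => f (n + 1 + j))]
  congr 1
  refine Finset.sum_congr rfl fun a ha => ?_
  rw [Finset.mem_range] at ha
  congr 1
  omega

/-- The right-hand threshold counts the letters of the reduced alphabet, without ±(a+1), that exceed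
the new letter. If the new letter is negative, its positive counterpart is larger but absent, whence
the correction by 1. -/
theorem prec_snoc_iff (a : Fin (n + 2)) (s : ℤˣ) (b : Fin (n + 1)) (t : ℤˣ) :
    Prec (s * (((a : ℕ) : ℤ) + 1)) (t * (((a.succAbove b : ℕ) : ℤ) + 1)) ↔
      lastExp b t < lastExp a s - if s = -1 then 1 else 0 := by
  have hb := b.2
  have ha := a.2
  have h : ((a.succAbove b : ℕ) = b ∧ (b : ℕ) < a) ∨
      ((a.succAbove b : ℕ) = b + 1 ∧ (a : ℕ) ≤ b) := by
    rcases lt_or_ge b.castSucc a with h | h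
    · left; rw [Fin.succAbove_of_castSucc_lt _ _ h]; exact ⟨rfl, h⟩
    · right; rw [Fin.succAbove_of_le_castSucc _ _ h]; exact ⟨rfl, h⟩
  have h1 : (1 : ℤˣ) ≠ -1 := by decide
  rcases Int.units_eq_one_or s with rfl | rfl <;> rcases Int.units_eq_one_or t with rfl | rfl <;>
    simp only [Prec, lastExp, if_neg h1, if_true, Units.val_one, Units.val_neg] <;> omega

/-- The t smallest exponents are shifted up by N, so 0, …, N-1 becomes t, …, t+N-1. -/
theorem sum_pow_threshold {K : Type*} [CommRing K] (u : K) {N t : ℕ} (h : t ≤ N) :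
    ∑ j ∈ Finset.range N, u ^ j * (if j < t then u ^ N else 1) = u ^ t * qInt u N := by
  obtain ⟨r, rfl⟩ := Nat.exists_eq_add_of_le h
  rw [Finset.sum_range_add, qInt, add_comm t r, Finset.sum_range_add, mul_add, add_comm,
    Finset.mul_sum, Finset.mul_sum]
  congr 1
  · exact Finset.sum_congr rfl fun j _ => by simp [pow_add]
  · refine Finset.sum_congr rfl fun j hj => ?_
    rw [if_pos (Finset.mem_range.1 hj)]
    ring

variable {K : Type*} [CommRing K]

/-- The weight `ε^(ℓ_B(σ)) q^(fmaj(σ))`. -/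
noncomputable def weight (ε q : K) (σ : SignedPerm n) : K := ε ^ σ.lengthB * q ^ σ.fmaj

/-- The signed Mahonian polynomial `∏ [2i]_{ε^i q}` of `B_n`. -/
def mahonian (ε q : K) (n : ℕ) : K := ∏ i ∈ Finset.range n, qInt (ε ^ (i + 1) * q) (2 * (i + 1))

theorem weight_snoc {ε : K} (hε : ε ^ 2 = 1) (q : K) (a : Fin (n + 2)) (s : ℤˣ)
    (τ : SignedPerm (n + 1)) :
    weight ε q (snoc a s τ) =
      ε ^ (n + 1 - a + if s = -1 then 1 else 0 : ℕ) * q ^ (if s = -1 then 1 else 0 : ℕ) *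
      ((if lastExp (τ.perm (Fin.last n)) (τ.sgn (Fin.last n)) <
        lastExp a s - (if s = -1 then 1 else 0) then q ^ (2 * (n + 1)) else 1) * weight ε q τ) := by
  rw [weight, weight, pow_lengthB_congr hε _ (signChar_snoc a s τ), fmaj, fmaj, maj_snoc, neg_snoc]
  simp only [prec_snoc_iff]
  split_ifs <;> ring

theorem lengthB_one : (1 : SignedPerm n).lengthB = 0 :=
  Nat.le_zero.1 (Nat.sInf_le ⟨[], rfl, by simp, rfl⟩)

/-- Induction, splitting τ by its own last letter. With u = ε^(n+1) q, a final descent costs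
q^(2(n+1)) = u^(2(n+1)), and 2(n+1) is the size of the alphabet of τ, so `sum_pow_threshold`
applies. -/
theorem sum_weight_snoc {ε : K} (hε : ε ^ 2 = 1) (q : K) (n : ℕ) :
    ∀ (a : Fin (n + 1)) (s : ℤˣ), ∑ τ : SignedPerm n, weight ε q (snoc a s τ) =
      (ε ^ (n + 1) * q) ^ lastExp a s * mahonian ε q n := by
  induction n with
  | zero =>
    intro a s
    have hτ : ∀ τ : SignedPerm 0, τ = 1 := fun τ => by ext i <;> exact i.elim0
    rw [Fintype.sum_eq_single 1 fun τ h => (h (hτ τ)).elim, weight,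
      pow_lengthB_congr hε _ (signChar_snoc a s 1), lengthB_one, fmaj, maj_of_le_one le_rfl,
      neg_snoc, neg_eq_sum, Fin.fin_one_eq_zero a]
    split_ifs <;> simp_all [mahonian, lastExp]
  | succ n ih =>
    intro a s
    have hu : (ε ^ (n + 1) * q) ^ (2 * (n + 1)) = q ^ (2 * (n + 1)) := by
      rw [mul_pow, ← pow_mul, show (n + 1) * (2 * (n + 1)) = 2 * ((n + 1) * (n + 1)) by ring,
        pow_mul, hε, one_pow, one_mul]
    obtain ⟨t, ht⟩ : ∃ t, t = lastExp a s - if s = -1 then 1 else 0 := ⟨_, rfl⟩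
    have ha := a.2
    have htN : t ≤ 2 * (n + 1) := by
      rw [ht, lastExp]; split_ifs <;> omega
    simp only [weight_snoc hε, ← ht, ← Finset.mul_sum]
    rw [sum_eq_sum_snoc]
    have : ∀ (b : Fin (n + 1)) (r : ℤˣ), ∑ τ : SignedPerm n,
        ((if lastExp ((snoc b r τ).perm (Fin.last n)) ((snoc b r τ).sgn (Fin.last n)) < t
          then q ^ (2 * (n + 1)) else 1) * weight ε q (snoc b r τ)) =
        (ε ^ (n + 1) * q) ^ lastExp b r *
          (if lastExp b r < t then (ε ^ (n + 1) * q) ^ (2 * (n + 1)) else 1) *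
          mahonian ε q n := by
      intro b r
      have h1 : ∀ τ : SignedPerm n, (snoc b r τ).perm (Fin.last n) = b := fun τ => by
        simp [snoc, snocPerm_last]
      have h2 : ∀ τ : SignedPerm n, (snoc b r τ).sgn (Fin.last n) = r := fun τ => by simp [snoc]
      simp only [h1, h2, ← Finset.mul_sum, ih, hu]
      ring
    simp only [this, ← Finset.sum_mul]
    rw [sum_lastExp (fun j => (ε ^ (n + 1) * q) ^ j *
      (if j < t then (ε ^ (n + 1) * q) ^ (2 * (n + 1)) else 1)), sum_pow_threshold _ htN,
      mahonian, mahonian, Finset.prod_range_succ]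
    have key : ε ^ (n + 1 - a + if s = -1 then 1 else 0 : ℕ) *
        q ^ (if s = -1 then 1 else 0 : ℕ) * (ε ^ (n + 1) * q) ^ t =
        (ε ^ (n + 1 + 1) * q) ^ lastExp a s := by
      rw [ht, lastExp]
      generalize (a : ℕ) = x at ha
      generalize n + 1 = N at ha
      obtain ⟨b, rfl⟩ := Nat.exists_eq_add_of_le (Nat.lt_succ_iff.1 ha)
      split_ifs
      · rw [show 2 * (x + b) + 1 - x = x + b + b + 1 by omega, Nat.add_sub_cancel,
          Nat.add_sub_cancel_left]
        -- The powers of ε on the two sides differ by exactly this even exponent.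
        have h : ε ^ (2 * (x + b)) = 1 := by rw [pow_mul, hε, one_pow]
        calc _ = ε ^ (b + 1 + (x + b) * (x + b + b)) * q ^ (x + b + b + 1) := by ring
          _ = ε ^ (2 * (x + b)) * ε ^ (b + 1 + (x + b) * (x + b + b)) * q ^ (x + b + b + 1) := by
            rw [h, one_mul]
          _ = _ := by ring
      · rw [Nat.add_sub_cancel_left, Nat.sub_zero, add_zero, pow_zero]
        ring
    rw [← key]
    ring

/-- The admissible last letters are 1, …, n, with exponents n, …, 1; the excluded letter n+1 has
exponent 0. -/
theorem sum_weight_last {ε : K} (hε : ε ^ 2 = 1) (q : K) (n : ℕ) :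
    ∑ σ : SignedPerm (n + 1),
      (if σ.sgn (Fin.last n) = 1 ∧ σ.perm (Fin.last n) ≠ Fin.last n then weight ε q σ else 0) =
      mahonian ε q n * (ε ^ (n + 1) * q * qInt (ε ^ (n + 1) * q) n) := by
  have hu : ∀ g : ℤˣ → K, ∑ s, g s = g 1 + g (-1) := fun g => by
    rw [show (Finset.univ : Finset ℤˣ) = {1, -1} from rfl, Finset.sum_pair (by decide)]
  have h1 : (1 : ℤˣ) ≠ -1 := by decide
  have hp : ∀ (a : Fin (n + 1)) (s : ℤˣ) (τ : SignedPerm n),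
      (snoc a s τ).perm (Fin.last n) = a := fun a s τ => by simp [snoc, snocPerm_last]
  have hs : ∀ (a : Fin (n + 1)) (s : ℤˣ) (τ : SignedPerm n),
      (snoc a s τ).sgn (Fin.last n) = s := fun a s τ => by simp [snoc]
  rw [sum_eq_sum_snoc]
  simp only [hp, hs, hu, true_and, h1.symm, false_and, if_false, Finset.sum_const_zero, add_zero]
  rw [Fin.sum_univ_castSucc]
  simp only [ne_eq, not_true_eq_false, if_false, Finset.sum_const_zero, add_zero,
    Fin.castSucc_ne_last, not_false_eq_true, if_true, sum_weight_snoc hε, lastExp, if_neg h1,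
    ← Finset.sum_mul, Fin.val_castSucc]
  rw [Fin.sum_univ_eq_sum_range (fun i => (ε ^ (n + 1) * q) ^ (n - i)) n, mul_comm]
  congr 1
  rw [qInt, Finset.mul_sum, ← Finset.sum_range_reflect fun i => ε ^ (n + 1) * q * _]
  refine Finset.sum_congr rfl fun i hi => ?_
  rw [Finset.mem_range] at hi
  rw [← pow_succ']
  congr 1
  omega

end SignedPerm

/-! ### Gaussian binomial coefficients -/

/-- The Gaussian binomial coefficient, by the `q`-Pascal recursion. -/
def gaussBinom {K : Type*} [CommRing K] (q : K) : ℕ → ℕ → K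
  | _, 0 => 1
  | 0, _ + 1 => 0
  | n + 1, k + 1 => gaussBinom q n k + q ^ (k + 1) * gaussBinom q n (k + 1)

section gaussBinom

variable {K : Type*} [CommRing K] (q : K)

@[simp] theorem gaussBinom_zero_right (n : ℕ) : gaussBinom q n 0 = 1 := by
  cases n <;> rfl

@[simp] theorem gaussBinom_zero_succ (k : ℕ) : gaussBinom q 0 (k + 1) = 0 := rfl

theorem gaussBinom_succ_succ (n k : ℕ) : gaussBinom q (n + 1) (k + 1) =
    gaussBinom q n k + q ^ (k + 1) * gaussBinom q n (k + 1) := rfl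

theorem gaussBinom_eq_zero_of_lt {n k : ℕ} (h : n < k) : gaussBinom q n k = 0 := by
  induction n generalizing k with
  | zero => obtain ⟨k, rfl⟩ := Nat.exists_eq_add_of_lt h; rfl
  | succ n ih =>
    obtain ⟨k, rfl⟩ := Nat.exists_eq_succ_of_ne_zero (by omega : k ≠ 0)
    rw [gaussBinom_succ_succ, ih (by omega), ih (by omega), mul_zero, add_zero]

theorem gaussBinom_self (n : ℕ) : gaussBinom q n n = 1 := by
  induction n with
  | zero => rfl
  | succ n ih =>
    rw [gaussBinom_succ_succ, ih, gaussBinom_eq_zero_of_lt q (Nat.lt_succ_self n), mul_zero,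
      add_zero]

/-- The dual q-Pascal rule, with d = n - k kept explicit to avoid subtraction. The shuffle recursion
needs both rules. -/
theorem gaussBinom_succ_succ' (k d : ℕ) : gaussBinom q (k + d + 1) (k + 1) =
    q ^ d * gaussBinom q (k + d) k + gaussBinom q (k + d) (k + 1) := by
  induction hm : k + d generalizing k d with
  | zero =>
    obtain ⟨rfl, rfl⟩ : k = 0 ∧ d = 0 := by omega
    simp [gaussBinom_succ_succ]
  | succ m ih =>
    rcases d with _ | d
    · obtain rfl : k = m + 1 := by omega
      rw [gaussBinom_self, gaussBinom_self, gaussBinom_eq_zero_of_lt q (Nat.lt_succ_self _)]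
      simp
    · have h1 := ih k d (by omega)
      have h2 := gaussBinom_succ_succ q m k
      rw [gaussBinom_succ_succ q (m + 1) k]
      rcases k with _ | k
      · obtain rfl : d = m := by omega
        simp only [zero_add, gaussBinom_zero_right] at h1 h2 ⊢
        linear_combination (q - 1) * h1 + h1 - h2
      · have h3 := ih k (d + 1) (by omega)
        have h4 := gaussBinom_succ_succ q m k
        linear_combination h3 + q ^ (k + 2) * h1 - q ^ (d + 1) * h4 - h2

end gaussBinom

/-! ### Shuffles with an increasing word -/

namespace Shuffle

section

open Classical

/-- The number of elements of `S` below `i`. -/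
def idx (S : Finset ℕ) (i : ℕ) : ℕ := (S.filter (· < i)).card

variable (D L : ℕ → Prop)

/-- The descents at the positions `i`, `i + 1` of a shuffle in which the positions in `S` carry a
word with descents `D` and the other positions carry an increasing word; `L` describes the letters
of the first word that are smaller than the letters of the second one. -/
def Desc (S : Finset ℕ) (i : ℕ) : Prop :=
  if i ∈ S then (if i + 1 ∈ S then D (idx S i) else ¬ L (idx S i)) else i + 1 ∈ S ∧ L (idx S i)

variable {K : Type*} [CommRing K] (q : K)

/-- `q` to the major index of the first `n + 1` letters of a shuffle. -/
noncomputable def majWeight (n : ℕ) (S : Finset ℕ) : K :=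
  ∏ i ∈ Finset.range n, if Desc D L S i then q ^ (i + 1) else 1

/-- `q` to the major index of the first `k + 1` letters of a word with descents `D`. -/
noncomputable def wordWeight (k : ℕ) : K :=
  ∏ j ∈ Finset.range k, if D j then q ^ (j + 1) else 1

theorem idx_insert {S : Finset ℕ} {i m : ℕ} (h : i ≤ m) : idx (insert m S) i = idx S i := by
  rw [idx, idx, Finset.filter_insert, if_neg (by omega)]

theorem idx_of_mem_powersetCard {S : Finset ℕ} {n k : ℕ}
    (hS : S ∈ Finset.powersetCard k (Finset.range n)) : idx S n = k := by
  obtain ⟨h, rfl⟩ := Finset.mem_powersetCard.1 hS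
  rw [idx, Finset.filter_true_of_mem fun x hx => Finset.mem_range.1 (h hx)]

theorem desc_insert {S : Finset ℕ} {i m : ℕ} (h : i + 1 < m) :
    Desc D L (insert m S) i ↔ Desc D L S i := by
  have h1 : i ≠ m := by omega
  have h2 : i + 1 ≠ m := by omega
  simp only [Desc, idx_insert (show i ≤ m by omega), Finset.mem_insert, h1, h2, false_or]

theorem majWeight_insert {S : Finset ℕ} {n m : ℕ} (h : n < m) :
    majWeight D L q n (insert m S) = majWeight D L q n S := by
  refine Finset.prod_congr rfl fun i hi => ?_
  rw [Finset.mem_range] at hi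
  simp only [desc_insert D L (show i + 1 < m by omega)]

theorem majWeight_succ (n : ℕ) (S : Finset ℕ) : majWeight D L q (n + 1) S =
    majWeight D L q n S * if Desc D L S n then q ^ (n + 1) else 1 :=
  Finset.prod_range_succ _ _


theorem notMem_of_le {n k : ℕ} {S : Finset ℕ}
    (hS : S ∈ Finset.powersetCard k (Finset.range n)) {m : ℕ} (h : n ≤ m) : m ∉ S := fun hm => by
  have := Finset.mem_range.1 ((Finset.mem_powersetCard.1 hS).1 hm)
  omega

/-- This and the next three lemmas treat the four ways in which positions n and n+1 can be filled.
As k letters of the first word come before position n, the new descent depends on k alone. -/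
theorem majWeight_insert_insert {n k : ℕ} {S : Finset ℕ}
    (hS : S ∈ Finset.powersetCard k (Finset.range n)) :
    majWeight D L q (n + 1) (insert (n + 1) (insert n S)) =
    majWeight D L q n (insert n S) * if D k then q ^ (n + 1) else 1 := by
  rw [majWeight_succ, majWeight_insert D L q (Nat.lt_succ_self n)]
  simp [Desc, idx_insert, idx_of_mem_powersetCard hS]

theorem majWeight_insert_self {n k : ℕ} {S : Finset ℕ}
    (hS : S ∈ Finset.powersetCard k (Finset.range n)) :
    majWeight D L q (n + 1) (insert n S) =
    majWeight D L q n (insert n S) * if L k then 1 else q ^ (n + 1) := by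
  rw [majWeight_succ]
  simp [Desc, idx_insert, idx_of_mem_powersetCard hS, notMem_of_le hS]

theorem majWeight_insert_succ {n k : ℕ} {S : Finset ℕ}
    (hS : S ∈ Finset.powersetCard k (Finset.range n)) :
    majWeight D L q (n + 1) (insert (n + 1) S) =
    majWeight D L q n S * if L k then q ^ (n + 1) else 1 := by
  rw [majWeight_succ, majWeight_insert D L q (Nat.lt_succ_self n)]
  simp [Desc, idx_insert, idx_of_mem_powersetCard hS, notMem_of_le hS]

theorem majWeight_succ_self {n k : ℕ} {S : Finset ℕ}
    (hS : S ∈ Finset.powersetCard k (Finset.range n)) :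
    majWeight D L q (n + 1) S = majWeight D L q n S := by
  rw [majWeight_succ]
  simp [Desc, notMem_of_le hS]

theorem sum_powersetCard_range_succ {M : Type*} [AddCommMonoid M] (f : Finset ℕ → M) (n k : ℕ) :
    ∑ S ∈ Finset.powersetCard (k + 1) (Finset.range (n + 1)), f S =
      ∑ S ∈ Finset.powersetCard (k + 1) (Finset.range n), f S +
        ∑ S ∈ Finset.powersetCard k (Finset.range n), f (insert n S) := by
  have hn : n ∉ Finset.range n := Finset.notMem_range_self
  rw [Finset.range_add_one, Finset.powersetCard_succ_insert hn, Finset.sum_union, Finset.sum_image]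
  · intro S hS T hT h
    have h1 := notMem_of_le hS le_rfl
    have h2 := notMem_of_le hT le_rfl
    rw [← Finset.erase_insert h1, h, Finset.erase_insert h2]
  · refine Finset.disjoint_left.2 fun S hS hS' => ?_
    obtain ⟨T, -, rfl⟩ := Finset.mem_image.1 hS'
    exact notMem_of_le hS le_rfl (Finset.mem_insert_self _ _)

/-- The shuffles of length `n + 1` that end with letter `k` of the first word. -/
noncomputable def endFirst (n k : ℕ) : K :=
  ∑ S ∈ Finset.powersetCard k (Finset.range n), majWeight D L q n (insert n S)

/-- The shuffles of length `n + 1` that contain `k` letters of the first word and end with a letter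
of the second one. -/
noncomputable def endSecond (n k : ℕ) : K :=
  ∑ S ∈ Finset.powersetCard k (Finset.range n), majWeight D L q n S

theorem endFirst_succ_succ (n k : ℕ) : endFirst D L q (n + 1) (k + 1) =
    endFirst D L q n k * (if D k then q ^ (n + 1) else 1) +
      endSecond D L q n (k + 1) * if L (k + 1) then q ^ (n + 1) else 1 := by
  rw [endFirst, sum_powersetCard_range_succ, add_comm, endFirst, endSecond, Finset.sum_mul,
    Finset.sum_mul]
  congr 1
  · exact Finset.sum_congr rfl fun S hS => majWeight_insert_insert D L q hS
  · exact Finset.sum_congr rfl fun S hS => majWeight_insert_succ D L q hS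

theorem endSecond_succ_succ (n k : ℕ) : endSecond D L q (n + 1) (k + 1) =
    endFirst D L q n k * (if L k then 1 else q ^ (n + 1)) + endSecond D L q n (k + 1) := by
  rw [endSecond, sum_powersetCard_range_succ, add_comm, endFirst, endSecond, Finset.sum_mul]
  congr 1
  · exact Finset.sum_congr rfl fun S hS => majWeight_insert_self D L q hS
  · exact Finset.sum_congr rfl fun S hS => majWeight_succ_self D L q hS

theorem endSecond_zero (n : ℕ) : endSecond D L q n 0 = 1 := by
  simp [endSecond, majWeight, Desc]

theorem endFirst_succ_zero (n : ℕ) :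
    endFirst D L q (n + 1) 0 = if L 0 then q ^ (n + 1) else 1 := by
  have h : (∅ : Finset ℕ) ∈ Finset.powersetCard 0 (Finset.range n) := by simp
  have := endSecond_zero D L q n
  simp only [endSecond, Finset.powersetCard_zero, Finset.sum_singleton] at this
  simp only [endFirst, Finset.powersetCard_zero, Finset.sum_singleton]
  rw [majWeight_insert_succ D L q h, this, one_mul]

/-- The major index of shuffles, refined by the last letter. -/
theorem endFirst_endSecond (h1 : ∀ j, L j → ¬ L (j + 1) → ¬ D j)
    (h2 : ∀ j, ¬ L j → L (j + 1) → D j) (n : ℕ) :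
    (∀ k, endFirst D L q n k =
      wordWeight D q k * (if L k then q ^ (n - k) else 1) * gaussBinom q n k) ∧
    ∀ k, endSecond D L q n (k + 1) =
      wordWeight D q k * (if L k then 1 else q ^ (k + 1)) * gaussBinom q n (k + 1) := by
  induction n with
  | zero =>
    refine ⟨fun k => ?_, fun k => by
      simp [endSecond, Finset.powersetCard_eq_empty.2 (show (∅ : Finset ℕ).card < k + 1 by simp)]⟩
    rcases k with _ | k <;> simp [endFirst, majWeight, wordWeight]
  | succ n ih =>
    obtain ⟨ihA, ihE⟩ := ih
    have hw : ∀ k, wordWeight D q (k + 1) = wordWeight D q k * if D k then q ^ (k + 1) else 1 :=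
      fun k => Finset.prod_range_succ _ _
    refine ⟨fun k => ?_, fun k => ?_⟩
    · rcases k with _ | k
      · rw [endFirst_succ_zero]; simp [wordWeight]
      · rw [endFirst_succ_succ, ihA, ihE, hw]
        -- For n < k the exponent n - k is truncated, but all coefficients vanish.
        rcases lt_or_ge n k with hk | hk
        · rw [gaussBinom_eq_zero_of_lt q hk, gaussBinom_eq_zero_of_lt q (by omega : n < k + 1),
            gaussBinom_eq_zero_of_lt q (by omega : n + 1 < k + 1)]
          ring
        obtain ⟨d, rfl⟩ := Nat.exists_eq_add_of_le hk
        have e1 := gaussBinom_succ_succ q (k + d) k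
        have e2 := gaussBinom_succ_succ' q k d
        rw [Nat.add_sub_cancel_left, show k + d + 1 - (k + 1) = d by omega]
        -- Of the eight cases `h1` and `h2` rule out two; each of the others is one of the two
        -- q-Pascal rules.
        by_cases a : L k <;> by_cases b : L (k + 1) <;> by_cases c : D k <;>
          simp only [a, b, c, if_true, if_false]
        · rw [e2]; ring
        · rw [e1]; ring
        · exact absurd c (h1 k a b)
        · rw [e2]; ring
        · rw [e1]; ring
        · exact absurd (h2 k a b) c
        · rw [e2]; ring
        · rw [e1]; ring
    · rw [endSecond_succ_succ, ihA, ihE]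
      rcases lt_or_ge n k with hk | hk
      · rw [gaussBinom_eq_zero_of_lt q hk, gaussBinom_eq_zero_of_lt q (by omega : n < k + 1),
          gaussBinom_eq_zero_of_lt q (by omega : n + 1 < k + 1)]
        ring
      obtain ⟨d, rfl⟩ := Nat.exists_eq_add_of_le hk
      have e2 := gaussBinom_succ_succ' q k d
      rw [Nat.add_sub_cancel_left]
      by_cases a : L k <;> simp only [a, if_true, if_false] <;> rw [e2]
      · ring
      · ring

end

end Shuffle

namespace SignedPerm

/-! ### Inserting fixed points -/

variable {n k : ℕ}

/-- The positions of the letters that are not fixed points. -/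
def nonfixed (σ : SignedPerm n) : Finset (Fin n) :=
  Finset.univ.filter fun i => ¬ (σ.sgn i = 1 ∧ σ.perm i = i)

theorem mem_nonfixed {σ : SignedPerm n} {i : Fin n} :
    i ∈ σ.nonfixed ↔ ¬ (σ.sgn i = 1 ∧ σ.perm i = i) := by simp [nonfixed]

theorem letter_eq_iff (σ : SignedPerm n) (i : Fin n) :
    σ.letter i = ((i : ℕ) : ℤ) + 1 ↔ σ.sgn i = 1 ∧ σ.perm i = i := by
  rcases Int.units_eq_one_or (σ.sgn i) with h | h <;> simp [letter, h, Fin.ext_iff]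
  omega

theorem isDerangement_iff (σ : SignedPerm n) :
    σ.IsDerangement ↔ ∀ i, ¬ (σ.sgn i = 1 ∧ σ.perm i = i) := by
  simp only [IsDerangement, ne_eq, letter_eq_iff]

theorem lastPos_iff (σ : SignedPerm (n + 1)) : σ.LastPos ↔ σ.sgn (Fin.last n) = 1 := by
  have h : 0 < σ.letter (Fin.last n) ↔ σ.sgn (Fin.last n) = 1 := by
    rcases Int.units_eq_one_or (σ.sgn (Fin.last n)) with h | h <;> simp [letter, h]
  rw [← h]
  refine ⟨fun h => h _ rfl, fun h i hi => ?_⟩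
  rwa [show i = Fin.last n from Fin.ext (by simpa using hi)]

variable (S : Finset (Fin n)) (hS : S.card = k)

/-- The signed permutation that acts on the positions in `S` as `α` and fixes the other ones. -/
noncomputable def expand (α : SignedPerm k) : SignedPerm n :=
  ⟨α.perm.extendDomain (S.orderIsoOfFin hS).toEquiv,
    fun i => if h : i ∈ S then α.sgn ((S.orderIsoOfFin hS).symm ⟨i, h⟩) else 1⟩

variable (α : SignedPerm k)

theorem expand_perm_apply (j : Fin k) : (expand S hS α).perm (S.orderIsoOfFin hS j) =
    S.orderIsoOfFin hS (α.perm j) :=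
  Equiv.Perm.extendDomain_apply_image _ (S.orderIsoOfFin hS).toEquiv _

theorem expand_sgn_apply (j : Fin k) :
    (expand S hS α).sgn (S.orderIsoOfFin hS j) = α.sgn j := by
  exact (dif_pos (Subtype.coe_prop _)).trans (by rw [Subtype.coe_eta, OrderIso.symm_apply_apply])

variable {S} in
theorem expand_perm_of_notMem {i : Fin n} (hi : i ∉ S) : (expand S hS α).perm i = i :=
  Equiv.Perm.extendDomain_apply_not_subtype _ _ hi

variable {S} in
theorem expand_sgn_of_notMem {i : Fin n} (hi : i ∉ S) : (expand S hS α).sgn i = 1 := by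
  simp [expand, hi]

variable {S} in
theorem exists_orderIsoOfFin_eq {i : Fin n} (hi : i ∈ S) :
    ∃ j : Fin k, i = S.orderIsoOfFin hS j :=
  ⟨(S.orderIsoOfFin hS).symm ⟨i, hi⟩, by simp⟩

theorem prod_sgn_expand {M : Type*} [CommMonoid M] (f : ℤˣ → M) (hf : f 1 = 1) :
    ∏ i, f ((expand S hS α).sgn i) = ∏ j, f (α.sgn j) := by
  rw [← Finset.prod_subset (Finset.subset_univ S) fun i _ hi => by
    rw [expand_sgn_of_notMem hS α hi, hf], ← Finset.prod_coe_sort,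
    ← (S.orderIsoOfFin hS).toEquiv.prod_comp]
  refine Finset.prod_congr rfl fun j _ => ?_
  rw [RelIso.coe_fn_toEquiv, expand_sgn_apply]

theorem signChar_expand : signChar (expand S hS α) = signChar α := by
  have h : ∏ i, (expand S hS α).sgn i = ∏ j, α.sgn j := prod_sgn_expand S hS α id rfl
  rw [signChar_apply, signChar_apply, h, expand, Equiv.Perm.sign_extendDomain]

theorem neg_expand : (expand S hS α).neg = α.neg := by
  have h := prod_sgn_expand S hS α
    (fun s => Multiplicative.ofAdd (if s = -1 then 1 else 0 : ℕ)) (by decide)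
  rw [neg_eq_sum, neg_eq_sum]
  exact Multiplicative.ofAdd.injective (by simpa only [← ofAdd_sum] using h)

theorem mem_nonfixed_expand (j : Fin k) :
    (S.orderIsoOfFin hS j : Fin n) ∈ (expand S hS α).nonfixed ↔
    ¬ (α.sgn j = 1 ∧ α.perm j = j) := by
  rw [mem_nonfixed, expand_sgn_apply, expand_perm_apply, Subtype.coe_inj,
    (S.orderIsoOfFin hS).injective.eq_iff]

theorem nonfixed_expand (hα : α.IsDerangement) : (expand S hS α).nonfixed = S := by
  rw [isDerangement_iff] at hα
  ext i
  by_cases hi : i ∈ S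
  · obtain ⟨j, rfl⟩ := exists_orderIsoOfFin_eq hS hi
    simpa only [mem_nonfixed_expand, hi, iff_true] using hα j
  · simp [mem_nonfixed, expand_perm_of_notMem hS α hi, expand_sgn_of_notMem hS α hi, hi]

theorem expand_injective : Function.Injective (expand S hS : SignedPerm k → SignedPerm n) := by
  intro α β h
  ext j
  · have h1 := expand_perm_apply S hS α j
    rw [h, expand_perm_apply, Subtype.coe_inj, (S.orderIsoOfFin hS).injective.eq_iff] at h1
    rw [h1]
  · rw [← expand_sgn_apply S hS α, h, expand_sgn_apply]

theorem exists_expand_eq (σ : SignedPerm n) (hσ : σ.nonfixed.card = k) :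
    ∃ α : SignedPerm k, α.IsDerangement ∧ expand σ.nonfixed hσ α = σ := by
  -- If |σ| moves i then it also moves |σ|(i), so both are nonfixed whatever their signs.
  have hmem : ∀ i, σ.perm i ∈ σ.nonfixed ↔ i ∈ σ.nonfixed := by
    intro i
    by_cases h : σ.perm i = i
    · rw [h]
    · simp [mem_nonfixed, h]
  set e := σ.nonfixed.orderIsoOfFin hσ with he
  let α : SignedPerm k := ⟨e.toEquiv.permCongr.symm (σ.perm.subtypePerm hmem), fun j => σ.sgn (e j)⟩
  have hα : expand σ.nonfixed hσ α = σ := by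
    ext i
    · by_cases hi : i ∈ σ.nonfixed
      · obtain ⟨j, rfl⟩ := exists_orderIsoOfFin_eq hσ hi
        rw [expand_perm_apply, ← he]
        simp [α, Equiv.permCongr_def]
      · rw [expand_perm_of_notMem _ _ hi]
        rw [mem_nonfixed, not_not] at hi
        rw [hi.2]
    · congr 1
      by_cases hi : i ∈ σ.nonfixed
      · obtain ⟨j, rfl⟩ := exists_orderIsoOfFin_eq hσ hi
        rw [expand_sgn_apply]
      · rw [expand_sgn_of_notMem _ _ hi]
        rw [mem_nonfixed, not_not] at hi
        rw [hi.1]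
  refine ⟨α, (isDerangement_iff _).2 fun j => ?_, hα⟩
  rw [← mem_nonfixed_expand σ.nonfixed hσ α j, hα]
  exact Subtype.coe_prop _

theorem sum_nonfixed_eq {M : Type*} [AddCommMonoid M] (f : SignedPerm n → M) :
    ∑ σ with σ.nonfixed = S, f σ = ∑ α : SignedPerm k with α.IsDerangement, f (expand S hS α) := by
  symm
  refine Finset.sum_bij (fun α _ => expand S hS α) (fun α hα => ?_)
    (fun α _ β _ h => expand_injective S hS h) (fun σ hσ => ?_) fun _ _ => rfl
  · simpa using nonfixed_expand S hS α (Finset.mem_filter.1 hα).2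
  · obtain rfl := (Finset.mem_filter.1 hσ).2
    obtain ⟨α, h1, h2⟩ := exists_expand_eq σ hS
    exact ⟨α, by simpa using h1, h2⟩

/-! ### The major index after inserting fixed points -/

/-- The descents of `α`, indexed by natural numbers from `0`. -/
def WordDesc (j : ℕ) : Prop :=
  ∃ h : j + 1 < k, Prec (α.letter ⟨j + 1, h⟩) (α.letter ⟨j, Nat.lt_of_succ_lt h⟩)

/-- The letters of `α` that are smaller than their position. -/
def WordLow (j : ℕ) : Prop := ∃ h : j < k, α.letter ⟨j, h⟩ < (j : ℤ) + 1

theorem not_wordDesc (j : ℕ) (h : WordLow α j) (h' : ¬ WordLow α (j + 1)) :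
    ¬ WordDesc α j := by
  rintro ⟨h1, h2⟩
  obtain ⟨h3, h4⟩ := h
  have h5 : ¬ α.letter ⟨j + 1, h1⟩ < ((j + 1 : ℕ) : ℤ) + 1 := fun h => h' ⟨h1, h⟩
  unfold Prec at h2
  push_cast at h5
  omega

/-- In a derangement a letter that is not low strictly exceeds its position, hence also the low
letter after it. -/
theorem wordDesc_of_not_wordLow (j : ℕ) (hα : α.IsDerangement) (h : ¬ WordLow α j)
    (h' : WordLow α (j + 1)) : WordDesc α j := by
  obtain ⟨h1, h2⟩ := h'
  refine ⟨h1, ?_⟩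
  have h3 : ¬ α.letter ⟨j, by omega⟩ < (j : ℤ) + 1 := fun h3 => h ⟨by omega, h3⟩
  have h4 := hα ⟨j, by omega⟩
  have h5 := hα ⟨j + 1, h1⟩
  unfold Prec
  push_cast at h2 h4 h5
  omega

theorem wordWeight_eq {K : Type*} [CommRing K] (q : K) (α : SignedPerm (k + 1)) :
    Shuffle.wordWeight (WordDesc α) q k = q ^ α.maj := by
  classical
  rw [maj_eq_sum, ← Finset.prod_pow_eq_pow_sum, Shuffle.wordWeight,
    ← Fin.prod_univ_eq_prod_range (fun j => if WordDesc α j then q ^ (j + 1) else 1) k]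
  refine Finset.prod_congr rfl fun j _ => ?_
  have : WordDesc α j ↔ Prec (α.letter j.succ) (α.letter j.castSucc) := by
    have h : (j : ℕ) + 1 < k + 1 := by omega
    simp only [WordDesc, h, exists_true_left]
    rfl
  simp only [this]
  split_ifs <;> simp

theorem idx_succ (T : Finset ℕ) (i : ℕ) :
    Shuffle.idx T (i + 1) = Shuffle.idx T i + if i ∈ T then 1 else 0 := by
  have : T.filter (· < i + 1) = T.filter (· < i) ∪ T.filter (· = i) := by
    rw [← Finset.filter_or]
    exact Finset.filter_congr fun x _ => by omega
  rw [Shuffle.idx, this, Finset.card_union_of_disjoint, Finset.filter_eq']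
  · split_ifs <;> simp [Shuffle.idx]
  · refine Finset.disjoint_left.2 fun x h1 h2 => ?_
    exact absurd (Finset.mem_filter.1 h2).2 (Finset.mem_filter.1 h1).2.ne

theorem idx_orderIsoOfFin (j : Fin k) :
    Shuffle.idx (S.map Fin.valEmbedding) (S.orderIsoOfFin hS j : Fin n) = j := by
  have h : (S.map Fin.valEmbedding).filter (· < ((S.orderIsoOfFin hS j : Fin n) : ℕ)) =
      (Finset.Iio j).image fun i => ((S.orderIsoOfFin hS i : Fin n) : ℕ) := by
    ext x
    simp only [Finset.mem_filter, Finset.mem_map, Finset.mem_image, Finset.mem_Iio]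
    constructor
    · rintro ⟨⟨y, hy, rfl⟩, hlt⟩
      obtain ⟨i, rfl⟩ := exists_orderIsoOfFin_eq hS hy
      exact ⟨i, (S.orderIsoOfFin hS).lt_iff_lt.1 hlt, rfl⟩
    · rintro ⟨i, hi, rfl⟩
      exact ⟨⟨_, Subtype.coe_prop _, rfl⟩, (S.orderIsoOfFin hS).lt_iff_lt.2 hi⟩
  rw [Shuffle.idx, h, Finset.card_image_of_injective, Fin.card_Iio]
  exact Fin.val_injective.comp (Subtype.val_injective.comp (S.orderIsoOfFin hS).injective)

theorem orderIsoOfFin_lt_iff (i j : Fin k) :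
    ((S.orderIsoOfFin hS i : Fin n) : ℕ) < (S.orderIsoOfFin hS j : Fin n) ↔ (i : ℕ) < j :=
  (S.orderIsoOfFin hS).lt_iff_lt

theorem letter_expand_apply (j : Fin k) : (expand S hS α).letter (S.orderIsoOfFin hS j) =
    α.sgn j * ((((S.orderIsoOfFin hS (α.perm j) : Fin n) : ℕ) : ℤ) + 1) := by
  rw [letter, expand_sgn_apply, expand_perm_apply]

/-- A letter of α never takes the value of an adjacent fixed point, so comparing it with that value
is the same as comparing it with its own position. The increasing embedding of [k] onto S preserves
that comparison, so lowness can be read off from α. -/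
theorem prec_expand_iff (S : Finset (Fin (n + 1))) (hS : S.card = k) (hα : α.IsDerangement)
    (i : Fin n) :
    Prec ((expand S hS α).letter i.succ) ((expand S hS α).letter i.castSucc) ↔
      Shuffle.Desc (WordDesc α) (WordLow α) (S.map Fin.valEmbedding) i := by
  have hm : (i : ℕ) ∈ S.map Fin.valEmbedding ↔ i.castSucc ∈ S := by
    rw [← Fin.val_castSucc]; exact Finset.mem_map' Fin.valEmbedding (a := i.castSucc)
  have hm' : (i : ℕ) + 1 ∈ S.map Fin.valEmbedding ↔ i.succ ∈ S := by
    rw [← Fin.val_succ]; exact Finset.mem_map' Fin.valEmbedding (a := i.succ)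
  have hidx := idx_succ (S.map Fin.valEmbedding) i
  rw [isDerangement_iff] at hα
  have hne : ∀ {x : Fin (n + 1)}, x ∉ S → ∀ j, ((S.orderIsoOfFin hS j : Fin (n + 1)) : ℕ) ≠ x := by
    intro x hx j h
    exact hx (Fin.ext h ▸ Subtype.coe_prop _)
  have hlow : ∀ j : Fin k, WordLow α j ↔ (α.sgn j = 1 → (α.perm j : ℕ) < j) := by
    intro j
    rcases Int.units_eq_one_or (α.sgn j) with h | h <;> simp [WordLow, letter, h]
    omega
  simp only [Shuffle.Desc, hm, hm'] at hidx ⊢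
  by_cases h1 : i.castSucc ∈ S <;> by_cases h2 : i.succ ∈ S <;>
    simp only [h1, h2, if_true, if_false, true_and, false_and] at hidx ⊢
  · obtain ⟨j, hj⟩ := exists_orderIsoOfFin_eq hS h1
    obtain ⟨j', hj'⟩ := exists_orderIsoOfFin_eq hS h2
    have e1 : Shuffle.idx (S.map Fin.valEmbedding) i = j := by
      rw [← idx_orderIsoOfFin S hS j, ← hj]; rfl
    have e2 : Shuffle.idx (S.map Fin.valEmbedding) (i + 1) = j' := by
      rw [← idx_orderIsoOfFin S hS j', ← hj']; rfl
    obtain ⟨j', hj'k⟩ := j'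
    obtain rfl : j' = j + 1 := by simpa [hidx, e1] using e2.symm
    rw [hj, hj', letter_expand_apply, letter_expand_apply, e1, WordDesc, exists_prop_of_true hj'k]
    exact prec_congr _ _ (orderIsoOfFin_lt_iff S hS _ _) (orderIsoOfFin_lt_iff S hS _ _)
  · obtain ⟨j, hj⟩ := exists_orderIsoOfFin_eq hS h1
    have e1 : Shuffle.idx (S.map Fin.valEmbedding) i = j := by
      rw [← idx_orderIsoOfFin S hS j, ← hj]; rfl
    have e3 := hne h2 (α.perm j)
    have e4 := orderIsoOfFin_lt_iff S hS j (α.perm j)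
    have e5 := hα j
    rw [← hj] at e4
    rw [Fin.ext_iff] at e5
    rw [e1, hlow, letter, expand_perm_of_notMem hS α h2, expand_sgn_of_notMem hS α h2, hj,
      letter_expand_apply]
    simp only [Fin.val_succ, Fin.val_castSucc] at e3 e4 ⊢
    rcases Int.units_eq_one_or (α.sgn j) with h | h <;>
      simp [h, Prec, -Finset.coe_orderIsoOfFin_apply] at e5 ⊢ <;> omega
  · obtain ⟨j, hj⟩ := exists_orderIsoOfFin_eq hS h2
    have e1 : Shuffle.idx (S.map Fin.valEmbedding) (i + 1) = j := by
      rw [← idx_orderIsoOfFin S hS j, ← hj]; rfl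
    have e3 := hne h1 (α.perm j)
    have e4 := orderIsoOfFin_lt_iff S hS (α.perm j) j
    rw [← hj] at e4
    rw [← add_zero (Shuffle.idx _ _), ← hidx, e1, hlow, letter.eq_1 _ i.castSucc,
      expand_perm_of_notMem hS α h1, expand_sgn_of_notMem hS α h1, hj, letter_expand_apply]
    simp only [Fin.val_succ, Fin.val_castSucc] at e3 e4 ⊢
    rcases Int.units_eq_one_or (α.sgn j) with h | h <;>
      simp [h, Prec, -Finset.coe_orderIsoOfFin_apply] <;> omega
  · rw [letter, letter, expand_perm_of_notMem hS α h1, expand_sgn_of_notMem hS α h1,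
      expand_perm_of_notMem hS α h2, expand_sgn_of_notMem hS α h2]
    simp [Prec]
    omega

theorem pow_maj_expand {K : Type*} [CommRing K] (q : K) (S : Finset (Fin (n + 1)))
    (hS : S.card = k) (hα : α.IsDerangement) : q ^ (expand S hS α).maj =
      Shuffle.majWeight (WordDesc α) (WordLow α) q n (S.map Fin.valEmbedding) := by
  classical
  rw [maj_eq_sum, ← Finset.prod_pow_eq_pow_sum, Shuffle.majWeight,
    ← Fin.prod_univ_eq_prod_range (fun i => if Shuffle.Desc (WordDesc α) (WordLow α)
      (S.map Fin.valEmbedding) i then q ^ (i + 1) else 1) n]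
  refine Finset.prod_congr rfl fun i _ => ?_
  simp only [prec_expand_iff α S hS hα]
  split_ifs <;> simp

end SignedPerm

namespace SignedPerm

/-! ### The decomposition by fixed points -/

/-- The set of positions that contains the last one, and the positions in `T`. -/
def withLast (n : ℕ) (T : Finset ℕ) : Finset (Fin (n + 1)) :=
  Finset.univ.filter fun i => (i : ℕ) ∈ insert n T

variable {n k : ℕ} {T : Finset ℕ}

theorem mem_withLast {i : Fin (n + 1)} : i ∈ withLast n T ↔ (i : ℕ) = n ∨ (i : ℕ) ∈ T := by
  simp [withLast]

theorem map_withLast (hT : T ⊆ Finset.range n) :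
    (withLast n T).map Fin.valEmbedding = insert n T := by
  ext x
  simp only [Finset.mem_map, mem_withLast, Fin.valEmbedding_apply, Finset.mem_insert]
  constructor
  · rintro ⟨i, hi, rfl⟩
    exact hi
  · intro hx
    have : x < n + 1 := by
      rcases hx with rfl | hx
      · omega
      · have := Finset.mem_range.1 (hT hx); omega
    exact ⟨⟨x, this⟩, hx, rfl⟩

theorem card_withLast (hT : T ∈ Finset.powersetCard k (Finset.range n)) :
    (withLast n T).card = k + 1 := by
  rw [← Finset.card_map Fin.valEmbedding, map_withLast (Finset.mem_powersetCard.1 hT).1,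
    Finset.card_insert_of_notMem (Shuffle.notMem_of_le hT le_rfl), (Finset.mem_powersetCard.1 hT).2]

/-- Passes from subsets of `Fin (n + 1)` to the subsets of ℕ used for shuffles. -/
theorem sum_filter_last_mem {M : Type*} [AddCommMonoid M] (f : Finset (Fin (n + 1)) → M) :
    ∑ S with Fin.last n ∈ S, f S = ∑ T ∈ (Finset.range n).powerset, f (withLast n T) := by
  have key : ∀ S : Finset (Fin (n + 1)), Fin.last n ∈ S →
      withLast n ((S.map Fin.valEmbedding).erase n) = S := by
    intro S hS
    ext i
    rw [mem_withLast, Finset.mem_erase]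
    have : (i : ℕ) ∈ S.map Fin.valEmbedding ↔ i ∈ S := Finset.mem_map' Fin.valEmbedding (a := i)
    rw [this]
    by_cases hi : i = Fin.last n
    · subst hi; simpa using hS
    · have : (i : ℕ) ≠ n := fun h => hi (Fin.ext h)
      simp [this]
  refine Finset.sum_nbij' (fun S => (S.map Fin.valEmbedding).erase n) (withLast n)
    (fun S _ => ?_) (fun T _ => ?_) (fun S hS => key S (Finset.mem_filter.1 hS).2)
    (fun T hT => ?_) (fun S hS => by rw [key S (Finset.mem_filter.1 hS).2])
  · refine Finset.mem_powerset.2 fun x hx => ?_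
    obtain ⟨hx, h⟩ := Finset.mem_erase.1 hx
    obtain ⟨i, -, rfl⟩ := Finset.mem_map.1 h
    have := i.2
    simp only [Fin.valEmbedding_apply, Finset.mem_range] at hx ⊢
    omega
  · simp [mem_withLast]
  · rw [Finset.mem_powerset] at hT
    rw [map_withLast hT]
    exact Finset.erase_insert fun h => by simpa using hT h

theorem orderIsoOfFin_last {S : Finset (Fin (n + 1))} (hS : S.card = k + 1)
    (h : Fin.last n ∈ S) : (S.orderIsoOfFin hS (Fin.last k) : Fin (n + 1)) = Fin.last n := by
  obtain ⟨j, hj⟩ := exists_orderIsoOfFin_eq hS h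
  refine le_antisymm (Fin.le_last _) ?_
  conv_lhs => rw [hj]
  exact (S.orderIsoOfFin hS).monotone (Fin.le_last j)

variable {K : Type*} [CommRing K]

theorem weight_expand {ε : K} (hε : ε ^ 2 = 1) (q : K) {S : Finset (Fin n)} (hS : S.card = k)
    (α : SignedPerm k) :
    weight ε q (expand S hS α) = ε ^ α.lengthB * q ^ α.neg * (q ^ 2) ^ (expand S hS α).maj := by
  rw [weight, pow_lengthB_congr hε 0 (τ := α) (by rw [signChar_expand, pow_zero, one_mul]), fmaj,
    neg_expand]
  ring

theorem sum_weight_withLast {ε : K} (hε : ε ^ 2 = 1) (q : K)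
    (hT : T ∈ Finset.powersetCard k (Finset.range n)) :
    ∑ σ with σ.nonfixed = withLast n T,
      (if σ.sgn (Fin.last n) = 1 ∧ σ.perm (Fin.last n) ≠ Fin.last n then weight ε q σ else 0) =
    ∑ α ∈ derangementsDelta (k + 1), ε ^ α.lengthB * q ^ α.neg *
      Shuffle.majWeight (WordDesc α) (WordLow α) (q ^ 2) n (insert n T) := by
  have hc := card_withLast hT
  have hl : Fin.last n ∈ withLast n T := mem_withLast.2 (Or.inl rfl)
  have he := orderIsoOfFin_last hc hl
  rw [sum_nonfixed_eq _ hc, derangementsDelta, ← Finset.filter_filter,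
    Finset.sum_filter (fun α : SignedPerm (k + 1) => α.LastPos)]
  refine Finset.sum_congr rfl fun α hα => ?_
  have hα := (Finset.mem_filter.1 hα).2
  have h1 : (expand _ hc α).sgn (Fin.last n) = α.sgn (Fin.last k) := by
    conv_lhs => rw [← he, expand_sgn_apply]
  have h2 : α.sgn (Fin.last k) = 1 → (expand _ hc α).perm (Fin.last n) ≠ Fin.last n := by
    intro h h'
    rw [← nonfixed_expand _ hc α hα, mem_nonfixed, h1] at hl
    exact hl ⟨h, h'⟩
  simp only [lastPos_iff, h1, and_iff_left_of_imp h2, weight_expand hε, pow_maj_expand _ _ _ hc hα,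
    map_withLast (Finset.mem_powersetCard.1 hT).1]

theorem sum_weight_last_eq_sum_dDelta {ε : K} (hε : ε ^ 2 = 1) (q : K) (n : ℕ) :
    ∑ σ : SignedPerm (n + 1),
      (if σ.sgn (Fin.last n) = 1 ∧ σ.perm (Fin.last n) ≠ Fin.last n then weight ε q σ else 0) =
      ∑ k ∈ Finset.range (n + 1),
        (q ^ 2) ^ (n - k) * gaussBinom (q ^ 2) n k * dDelta (k + 1) ε q := by
  rw [← Finset.sum_fiberwise (s := Finset.univ) (g := nonfixed)]
  have h0 : ∀ S : Finset (Fin (n + 1)), Fin.last n ∉ S →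
      ∑ σ with σ.nonfixed = S, (if σ.sgn (Fin.last n) = 1 ∧ σ.perm (Fin.last n) ≠ Fin.last n
        then weight ε q σ else 0) = 0 := by
    intro S hS
    refine Finset.sum_eq_zero fun σ hσ => if_neg fun h => ?_
    rw [← (Finset.mem_filter.1 hσ).2, mem_nonfixed, not_not] at hS
    exact h.2 hS.2
  rw [← Finset.sum_filter_of_ne (p := fun S => Fin.last n ∈ S)
    fun S _ h => by_contra fun h' => h (h0 S h'), sum_filter_last_mem, Finset.sum_powerset,
    Finset.card_range]
  refine Finset.sum_congr rfl fun k _ => ?_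
  rw [Finset.sum_congr rfl fun T hT => sum_weight_withLast hε q hT, Finset.sum_comm, dDelta,
    Finset.mul_sum]
  refine Finset.sum_congr rfl fun α hα => ?_
  obtain ⟨hd, hp⟩ := (Finset.mem_filter.1 hα).2
  rw [← Finset.mul_sum]
  -- No letter exceeds k+1 and the last one is not fixed, so it is low; this selects the factor
  -- q^(2(n-k)).
  have hlow : WordLow α k := by
    refine ⟨Nat.lt_succ_self k, ?_⟩
    have h1 := hd (Fin.last k)
    rw [ne_eq, letter_eq_iff] at h1
    have h2 := (α.perm (Fin.last k)).2
    change α.letter (Fin.last k) < (k : ℤ) + 1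
    rcases Int.units_eq_one_or (α.sgn (Fin.last k)) with h | h <;>
      simp [letter, h, Fin.ext_iff] at h1 ⊢ <;> omega
  have := (Shuffle.endFirst_endSecond (WordDesc α) (WordLow α) (q ^ 2)
    (fun j => not_wordDesc α j) (fun j => wordDesc_of_not_wordLow α j hd) n).1 k
  rw [Shuffle.endFirst, if_pos hlow, wordWeight_eq] at this
  rw [this, fmaj]
  ring

end SignedPerm

/-! ### Inversion -/

section inversion

variable {K : Type*} [Field K] {q : K}

theorem qInt_add (q : K) (m n : ℕ) : qInt q (m + n) = qInt q m + q ^ m * qInt q n := by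
  simp only [qInt, Finset.sum_range_add, Finset.mul_sum, pow_add]

theorem qEvenProd_succ (q : K) (n : ℕ) :
    qEvenProd q (n + 1) = qEvenProd q n * qInt q (2 * (n + 1)) :=
  Finset.prod_Icc_succ_top (by omega) _

@[simp] theorem qEvenProd_zero (q : K) : qEvenProd q 0 = 1 := rfl

/-- Induction by the q-Pascal rule and [2(i+j)]_q = [2i]_q + q^(2i) [2j]_q. Stated without division,
it holds for every q. -/
theorem gaussBinom_mul_qEvenProd (q : K) (n : ℕ) : ∀ i j, i + j = n →
    gaussBinom (q ^ 2) n i * (qEvenProd q i * qEvenProd q j) = qEvenProd q n := by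
  induction n with
  | zero =>
    intro i j h
    obtain ⟨rfl, rfl⟩ : i = 0 ∧ j = 0 := by omega
    simp
  | succ n ih =>
    intro i j h
    rcases i with _ | i
    · obtain rfl : j = n + 1 := by omega
      simp
    rcases j with _ | j
    · obtain rfl : i = n := by omega
      simp [gaussBinom_self]
    have h1 := ih i (j + 1) (by omega)
    have h2 := ih (i + 1) j (by omega)
    have h3 : qInt q (2 * (n + 1)) =
        qInt q (2 * (i + 1)) + (q ^ 2) ^ (i + 1) * qInt q (2 * (j + 1)) := by
      rw [← pow_mul, ← qInt_add]; congr 1; omega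
    rw [gaussBinom_succ_succ, qEvenProd_succ q n, h3]
    rw [qEvenProd_succ] at h1 h2 ⊢
    rw [qEvenProd_succ q j]
    linear_combination qInt q (2 * (i + 1)) * h1 + (q ^ 2) ^ (i + 1) * qInt q (2 * (j + 1)) * h2

theorem sum_neg_one_pow_gaussBinom (q : K) (n : ℕ) :
    ∑ k ∈ Finset.range (n + 2), (-1) ^ k * q ^ (k * (k - 1) / 2) * gaussBinom q (n + 1) k = 0 := by
  -- The q-Pascal rule telescopes the partial sums; the closed form vanishes at m = n+1.
  have key : ∀ m, ∑ k ∈ Finset.range (m + 1),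
      (-1) ^ k * q ^ (k * (k - 1) / 2) * gaussBinom q (n + 1) k =
      (-1) ^ m * q ^ (m * (m + 1) / 2) * gaussBinom q n m := by
    intro m
    induction m with
    | zero => simp
    | succ m ih =>
      rw [Finset.sum_range_succ, ih, gaussBinom_succ_succ, Nat.add_sub_cancel, mul_comm (m + 1) m]
      have : (m + 1) * (m + 1 + 1) / 2 = m * (m + 1) / 2 + (m + 1) := by
        rw [show (m + 1) * (m + 1 + 1) = m * (m + 1) + (m + 1) * 2 by ring]
        exact Nat.add_mul_div_right _ _ two_pos
      rw [this]
      ring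
  rw [key, gaussBinom_eq_zero_of_lt q (Nat.lt_succ_self n), mul_zero]

theorem qEvenProd_ne_zero (hq : ∀ n, qInt q (2 * (n + 1)) ≠ 0) (n : ℕ) : qEvenProd q n ≠ 0 := by
  induction n with
  | zero => simp
  | succ n ih => rw [qEvenProd_succ]; exact mul_ne_zero ih (hq n)

/-- The two q-exponential series are inverse: each higher coefficient of the product is a multiple
of the vanishing alternating sum in base q². -/
theorem mk_mul_mk_eq_one (hq : ∀ n, qInt q (2 * (n + 1)) ≠ 0) :
    PowerSeries.mk (fun j => (-1) ^ j * q ^ (j ^ 2 + j) / qEvenProd q j) *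
      PowerSeries.mk (fun i => q ^ (2 * i) / qEvenProd q i) = 1 := by
  ext s
  rw [PowerSeries.coeff_mul]
  rcases s with _ | s
  · simp
  rw [PowerSeries.coeff_one, if_neg (Nat.succ_ne_zero s)]
  have hP := qEvenProd_ne_zero hq
  have : ∀ p ∈ Finset.HasAntidiagonal.antidiagonal (s + 1),
      PowerSeries.coeff p.1 (PowerSeries.mk fun j => (-1) ^ j * q ^ (j ^ 2 + j) / qEvenProd q j) *
      PowerSeries.coeff p.2 (PowerSeries.mk fun i => q ^ (2 * i) / qEvenProd q i) =
      q ^ (2 * (s + 1)) / qEvenProd q (s + 1) * ((-1) ^ p.1 * (q ^ 2) ^ (p.1 * (p.1 - 1) / 2) *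
        gaussBinom (q ^ 2) (s + 1) p.1) := by
    rintro ⟨i, j⟩ h
    rw [Finset.HasAntidiagonal.mem_antidiagonal] at h
    simp only at h
    have h1 := gaussBinom_mul_qEvenProd q (s + 1) i j h
    have h2 : gaussBinom (q ^ 2) (s + 1) i =
        qEvenProd q (s + 1) / (qEvenProd q i * qEvenProd q j) := by
      rw [eq_div_iff (mul_ne_zero (hP i) (hP j)), h1]
    have h3 : i ^ 2 + i + 2 * j = 2 * (s + 1) + 2 * (i * (i - 1) / 2) := by
      rw [Nat.mul_div_cancel' (Nat.even_mul_pred_self i).two_dvd, ← h]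
      rcases i with _ | i
      · simp
      · rw [Nat.add_sub_cancel]; ring
    simp only [PowerSeries.coeff_mk]
    rw [h2]
    have := hP i
    have := hP j
    have := hP (s + 1)
    field_simp
    rw [← pow_mul, ← pow_add, h3, ← pow_add]
  rw [Finset.sum_congr rfl this, ← Finset.mul_sum,
    Finset.Nat.sum_antidiagonal_eq_sum_range_succ_mk]
  simp only
  rw [sum_neg_one_pow_gaussBinom, mul_zero]

/-- The inversion of a `q`-binomial transform. -/
theorem gaussBinom_inversion (hq : ∀ n, qInt q (2 * (n + 1)) ≠ 0) {c d : ℕ → K}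
    (h : ∀ n, c n = ∑ k ∈ Finset.range (n + 1), (q ^ 2) ^ (n - k) * gaussBinom (q ^ 2) n k * d k)
    (n : ℕ) : d n = qEvenProd q n * ∑ j ∈ Finset.range (n + 1),
      (-1) ^ j * q ^ (j ^ 2 + j) / qEvenProd q j * (c (n - j) / qEvenProd q (n - j)) := by
  have hP := qEvenProd_ne_zero hq
  -- After division by [2]_q⋯[2n]_q the transform is a Cauchy product.
  have hc : PowerSeries.mk (fun n => c n / qEvenProd q n) =
      PowerSeries.mk (fun i => q ^ (2 * i) / qEvenProd q i) *
        PowerSeries.mk (fun n => d n / qEvenProd q n) := by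
    ext n
    rw [mul_comm, PowerSeries.coeff_mul, Finset.Nat.sum_antidiagonal_eq_sum_range_succ_mk]
    simp only [PowerSeries.coeff_mk]
    rw [h, Finset.sum_div]
    refine Finset.sum_congr rfl fun k hk => ?_
    have hk : k + (n - k) = n := by have := Finset.mem_range.1 hk; omega
    have h1 := gaussBinom_mul_qEvenProd q n k (n - k) hk
    rw [← h1, pow_mul]
    have h2 : gaussBinom (q ^ 2) n k ≠ 0 := fun h0 => hP n (by rw [← h1, h0, zero_mul])
    have := hP k
    have := hP (n - k)
    field_simp
  have hd : PowerSeries.mk (fun n => d n / qEvenProd q n) =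
      PowerSeries.mk (fun j => (-1) ^ j * q ^ (j ^ 2 + j) / qEvenProd q j) *
        PowerSeries.mk (fun n => c n / qEvenProd q n) := by
    rw [hc, ← mul_assoc, mk_mul_mk_eq_one hq, one_mul]
  have := congrArg (PowerSeries.coeff n) hd
  rw [PowerSeries.coeff_mul, Finset.Nat.sum_antidiagonal_eq_sum_range_succ_mk] at this
  simp only [PowerSeries.coeff_mk] at this
  rw [← this, mul_div_cancel₀ _ (hP n)]

end inversion

/-! ### Signed evaluations -/

section evaluation

variable {K : Type*} [Field K] {q ε : K}

theorem one_sub_mul_qInt (q : K) (n : ℕ) : (1 - q) * qInt q n = 1 - q ^ n :=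
  mul_neg_geom_sum q n

/-- Both (1 - εq)[2r]_{εq} and (1 - q)[2r]_q equal 1 - q^(2r). -/
theorem qInt_signed (hε : ε ^ 2 = 1) (h : 1 - ε * q ≠ 0) (r : ℕ) :
    qInt (ε * q) (2 * r) = qInt q (2 * r) * ((1 - q) / (1 - ε * q)) := by
  have h1 := one_sub_mul_qInt (ε * q) (2 * r)
  rw [mul_pow, pow_mul, hε, one_pow, one_mul, ← one_sub_mul_qInt] at h1
  rw [← mul_div_assoc, eq_div_iff h]
  linear_combination h1

theorem pow_eq_of_even (hε : ε ^ 2 = 1) {n : ℕ} (hn : Even n) : ε ^ n = 1 := by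
  obtain ⟨r, rfl⟩ := hn.two_dvd
  rw [pow_mul, hε, one_pow]

/-- Only the factors with odd index i ≤ n are twisted by ε, and there are ⌊(n+1)/2⌋ of them. -/
theorem mahonian_eq (hε : ε ^ 2 = 1) (h : 1 - ε * q ≠ 0) (n : ℕ) :
    SignedPerm.mahonian ε q n = qEvenProd q n * ((1 - q) / (1 - ε * q)) ^ ((n + 1) / 2) := by
  induction n with
  | zero => simp [SignedPerm.mahonian]
  | succ n ih =>
    rw [SignedPerm.mahonian, Finset.prod_range_succ, ← SignedPerm.mahonian, ih, qEvenProd_succ]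
    rcases Nat.even_or_odd n with hn | hn
    · rw [pow_succ, pow_eq_of_even hε hn, one_mul, qInt_signed hε h,
        show (n + 1 + 1) / 2 = (n + 1) / 2 + 1 by have := Nat.even_iff.1 hn; omega]
      ring
    · rw [pow_eq_of_even hε hn.add_one, one_mul,
        show (n + 1 + 1) / 2 = (n + 1) / 2 by have := Nat.odd_iff.1 hn; omega]
      ring

/-- For even n the factor [n]_{εq} supplies one more twisted quotient, which turns the floor of
(n+1)/2 into the ceiling. -/
theorem mahonian_mul_eq (hε : ε ^ 2 = 1) (h : 1 - ε * q ≠ 0) (n : ℕ) :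
    SignedPerm.mahonian ε q n * (ε ^ (n + 1) * q * qInt (ε ^ (n + 1) * q) n) =
      qEvenProd q n * (q * qInt q n * ε ^ (n + 1) *
        ((1 - q) / (1 - ε * q)) ^ ((n + 1) ⌈/⌉ 2)) := by
  rw [mahonian_eq hε h, Nat.ceilDiv_eq_add_pred_div]
  rcases Nat.even_or_odd n with hn | hn
  · rw [pow_succ ε, pow_eq_of_even hε hn, one_mul,
      show (n + 1 + 2 - 1) / 2 = (n + 1) / 2 + 1 by have := Nat.even_iff.1 hn; omega]
    obtain ⟨r, rfl⟩ := hn.two_dvd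
    rw [qInt_signed hε h]
    ring
  · rw [pow_eq_of_even hε hn.add_one, one_mul,
      show (n + 1 + 2 - 1) / 2 = (n + 1) / 2 by have := Nat.odd_iff.1 hn; omega]
    ring

theorem dDelta_succ (hε : ε ^ 2 = 1) (h : 1 - ε * q ≠ 0)
    (hq : ∀ n, qInt q (2 * (n + 1)) ≠ 0) (n : ℕ) :
    dDelta (n + 1) ε q = qEvenProd q n * ∑ k ∈ Finset.range n,
      (-1) ^ k * q ^ (k ^ 2 + k + 1) * qInt q (n - k) / qEvenProd q k *
        ε ^ (n + 1 - k) * ((1 - q) / (1 - ε * q)) ^ ((n + 1 - k) ⌈/⌉ 2) := by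
  have hc : ∀ n, qEvenProd q n * (q * qInt q n * ε ^ (n + 1) *
      ((1 - q) / (1 - ε * q)) ^ ((n + 1) ⌈/⌉ 2)) =
      ∑ k ∈ Finset.range (n + 1),
        (q ^ 2) ^ (n - k) * gaussBinom (q ^ 2) n k * dDelta (k + 1) ε q := fun n => by
    rw [← mahonian_mul_eq hε h, ← SignedPerm.sum_weight_last hε,
      SignedPerm.sum_weight_last_eq_sum_dDelta hε]
  -- The term j = n is split off because it contains [0]_q = 0.
  rw [gaussBinom_inversion hq hc n, Finset.sum_range_succ]
  simp only [mul_div_cancel_left₀ _ (qEvenProd_ne_zero hq _)]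
  rw [Nat.sub_self, show qInt q 0 = 0 from Finset.sum_range_zero _]
  simp only [mul_zero, zero_mul, add_zero]
  congr 1
  refine Finset.sum_congr rfl fun k hk => ?_
  rw [show n + 1 - k = n - k + 1 by have := Finset.mem_range.1 hk; omega]
  ring

end evaluation

/-! ### Specialization to the rational function field -/

theorem RatFunc.X_pow_ne_one {n : ℕ} (hn : n ≠ 0) : (RatFunc.X : RatFunc ℚ) ^ n ≠ 1 := by
  intro h
  have h1 : (Polynomial.X : Polynomial ℚ) ^ n = 1 := by
    apply RatFunc.algebraMap_injective ℚ
    rw [map_pow, RatFunc.algebraMap_X, h, map_one]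
  have := congrArg Polynomial.natDegree h1
  rw [Polynomial.natDegree_X_pow, Polynomial.natDegree_one] at this
  exact hn this

theorem mainTheorem5 (n : ℕ) (hn : 2 ≤ n) (q : RatFunc ℚ) (hq : q = RatFunc.X)
    (ε : RatFunc ℚ) (hε : ε = 1 ∨ ε = -1) :
    dDelta n ε q =
      qEvenProd q (n - 1) *
        ∑ k ∈ Finset.range (n - 1),
          (-1) ^ k * q ^ (k ^ 2 + k + 1) * qInt q (n - k - 1) / qEvenProd q k *
            ε ^ (n - k) * ((1 - q) / (1 - ε * q)) ^ ((n - k) ⌈/⌉ 2) := by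
  have hε2 : ε ^ 2 = 1 := by rcases hε with rfl | rfl <;> ring
  have hX : ∀ m ≠ 0, q ^ m ≠ 1 := fun m hm => hq ▸ RatFunc.X_pow_ne_one hm
  -- Otherwise 1 - q² = (1 + εq)(1 - εq) would vanish.
  have h1 : 1 - ε * q ≠ 0 := fun h => hX 2 two_ne_zero <| by
    linear_combination -(1 + ε * q) * h - q ^ 2 * hε2
  have h2 : ∀ m, qInt q (2 * (m + 1)) ≠ 0 := fun m h => hX (2 * (m + 1)) (by omega) <| by
    have := one_sub_mul_qInt q (2 * (m + 1))
    rw [h] at this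
    linear_combination this
  obtain ⟨m, rfl⟩ : ∃ m, n = m + 1 := ⟨n - 1, by omega⟩
  rw [dDelta_succ hε2 h1 h2]
  simp only [Nat.add_sub_cancel, show ∀ k, m + 1 - k - 1 = m - k from fun k => by omega]
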